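/- A $t$-query quantum algorithm $\mathcal A$ on inputs $x\in\{-1,1\}^n$ acts on the space $\mathbb C^{n+1}\otimes\mathbb C^d$ for some $d\in\mathbb N$. Its oracle is the phase oracle $O_x=\mathrm{Diag}(x_1,\dots,x_n,1)\otimes I_d$ (the last basis label of the query register is an idle query). The algorithm is given by a unit vector $\psi$ and unitaries $U_0,\dots,U_t$, none of which depends on $x$, together with a two-outcome measurement $\{E_{+1},E_{-1}\}$ independent of $x$ (positive semidefinite operators with $E_{+1}+E_{-1}=I$). On input $x$ it prepares $\psi_x=U_tO_xU_{t-1}O_x\cdots U_1O_xU_0\psi$ and returns the sign $s\in\{-1,1\}$ with probability $\langle\psi_x,E_s\psi_x\rangle$; thus $\mathbb E[\mathcal A(x)]=\langle\psi_x,E_{+1}\psi_x\rangle-\langle\psi_x,E_{-1}\psi_x\rangle$. A real $n$-variable polynomial $f$ is bounded if it maps $\{-1,1\}^n$ to $[-1,1]$, and quartic if its degree is $4$. Theorem. For any $C>0$, there exist an $n\in\mathbb N$, an $\varepsilon>0$ and a bounded quartic $n$-variable polynomial $f$ such that no two-query quantum algorithm $\mathcal A$ satisfies $$|\mathbb E[\mathcal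 A(x)]-C f(x)|<\varepsilon\quad\text{for every }x\in\{-1,1\}^n.$$ -/

import Mathlib

open scoped Matrix ComplexOrder

namespace QuantumQuery

/-- The Boolean hypercube `{-1,1}^n`. -/
abbrev Cube (n : ℕ) : Type := Fin n → ℤˣ

/-- A point of the hypercube, viewed as a real vector. -/
def Cube.toReal {n : ℕ} (x : Cube n) : Fin n → ℝ := fun i => ((x i : ℤ) : ℝ)

/-- A polynomial is bounded if it maps the hypercube to `[-1,1]`. -/
def IsBoundedOnCube {n : ℕ} (f : MvPolynomial (Fin n) ℝ) : Prop :=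
  ∀ x : Cube n, MvPolynomial.eval x.toReal f ∈ Set.Icc (-1 : ℝ) 1

/-- Labels of the computational basis of the register of an algorithm: a query register with
basis labels `1, …, n` and one extra idle label `none`, and a `d`-dimensional workspace. -/
abbrev Reg (n d : ℕ) : Type := Option (Fin n) × Fin d

/-- The diagonal entries of the oracle: `x i` at the label `i`, and `1` at the idle label. -/
def phase {n : ℕ} (x : Cube n) : Option (Fin n) → ℂ
  | none => 1
  | some i => ((x i : ℤ) : ℂ)

/-- The phase oracle `|i⟩|w⟩ ↦ x_i |i⟩|w⟩`, `|none⟩|w⟩ ↦ |none⟩|w⟩`. -/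
def oracle {n : ℕ} (d : ℕ) (x : Cube n) : Matrix (Reg n d) (Reg n d) ℂ :=
  Matrix.diagonal fun r => phase x r.1

/-- A `t`-query quantum algorithm on `n`-bit inputs that returns a sign: a workspace dimension, a
unit initial state, `t + 1` unitaries that do not depend on the input, and a two-outcome
measurement (POVM) with outcomes in `{-1,1}`. -/
structure Algorithm (n t : ℕ) where
  d : ℕ
  init : Reg n d → ℂ
  init_unit : star init ⬝ᵥ init = 1
  U : Fin (t + 1) → Matrix.unitaryGroup (Reg n d) ℂ
  effect : ℤˣ → Matrix (Reg n d) (Reg n d) ℂ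
  effect_posSemidef : ∀ s, (effect s).PosSemidef
  effect_sum : ∑ s, effect s = 1

namespace Algorithm

variable {n t : ℕ}

/-- The state after `k` queries on input `x`, that is `U_k O_x U_{k-1} O_x ⋯ O_x U_0` applied to
the initial state. -/
def stateAfter (A : Algorithm n t) (x : Cube n) : (k : ℕ) → k < t + 1 → Reg n A.d → ℂ
  | 0, h => (A.U ⟨0, h⟩).1 *ᵥ A.init
  | k + 1, h =>
      (A.U ⟨k + 1, h⟩).1 *ᵥ (oracle A.d x *ᵥ A.stateAfter x k (Nat.lt_of_succ_lt h))

/-- The state that is measured. -/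
def finalState (A : Algorithm n t) (x : Cube n) : Reg n A.d → ℂ :=
  A.stateAfter x t (Nat.lt_succ_self t)

/-- The probability (Born rule) that the algorithm returns the sign `s` on input `x`. -/
noncomputable def prob (A : Algorithm n t) (x : Cube n) (s : ℤˣ) : ℝ :=
  (star (A.finalState x) ⬝ᵥ (A.effect s *ᵥ A.finalState x)).re

/-- The expected output `𝔼[A(x)]` on input `x`. -/
noncomputable def expectation (A : Algorithm n t) (x : Cube n) : ℝ :=
  ∑ s : ℤˣ, ((s : ℤ) : ℝ) * A.prob x s

end Algorithm

end QuantumQuery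

/-!
Let `T` be a partial Steiner triple system with `m ^ 2` edges on `3 m` vertices (the edges are
`{x_i, y_j, z_{i+j}}` for `i, j ∈ ℤ/m`), let `z` be one more variable, and for signs `σ` put
`p = ∑ e, σ e * ∏ v ∈ insert z (T e), x v`. The counterexample is `f = p / B`, where `B` bounds
`|p|` on the cube; it is refuted by pairing with `p`, the dual witness, in `L²` of the cube.

* Two-query algorithms correlate badly with `p`, whatever `σ` is: the sum of `p x * 𝔼[A(x)]` over
  the cube is at most `5 * 2 ^ n` (`abs_sum_edgeForm_mul_expectation_le`). Before the last unitary
  the state is `∑ k l, x_k x_l • path k l`, where `path k l` is the part of the computation that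
  queries `k` and then `l`. The outcome probabilities are positive semidefinite quadratic forms in
  this state, and pairing with `p` keeps exactly the quadruples of queries that hit `z` and the
  three vertices of an edge. One half of such a quadruple is `{z, j}`, so that what is left is a
  sum over `j` of pairings of `path z j + path j z` with `∑ k l, ± path k l` over the `k, l` that
  complete `j` to an edge. The paths have total squared norm `1`. As two vertices determine the
  third, each path occurs for at most one `j` and the paths that complete one `j` are orthogonal;
  hence both families have total squared norm `O(1)`.
* The correlation of `p` with itself is large: it is `2 ^ n * m ^ 2` (`sum_edgeForm_sq`), since
  distinct monomials are orthogonal.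
* For suitable signs `B` is small: an exponential moment bound over random `σ` and a union bound
  over the cube give `B ≤ (n + 1) / lam + lam * m ^ 2 / 2` for any `lam > 0`
  (`exists_signs_abs_edgeForm_le`). With `n = 3 m + 1`, `lam` a small multiple of `C` and `m` large,
  `C * m ^ 2 > 6 * B`.

If `|𝔼[A(x)] - C f(x)| < 1 / B` on the cube, pairing with `p` gives
`C * m ^ 2 / B ≤ 5 + 1`, which contradicts the last inequality.
-/

namespace QuantumQuery

/-! ### Fourier analysis on the cube -/

/-- The real counterpart of `phase`: the coordinate `x i` at the label `i`, and `1` at the idle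
label. -/
def character {n : ℕ} (x : Cube n) : Option (Fin n) → ℝ
  | none => 1
  | some i => x.toReal i

@[simp] lemma character_some {n : ℕ} (x : Cube n) (i : Fin n) :
    character x (some i) = x.toReal i := rfl

lemma phase_eq_character {n : ℕ} (x : Cube n) (i : Option (Fin n)) :
    phase x i = (character x i : ℂ) := by
  cases i <;> simp [phase, character, Cube.toReal]

lemma toReal_mul_self {n : ℕ} (x : Cube n) (v : Fin n) : x.toReal v * x.toReal v = 1 := by
  rcases Int.units_eq_one_or (x v) with h | h <;> simp [Cube.toReal, h]

lemma sum_cube_eq_zero_of_flip {n : ℕ} (v : Fin n) (g : Cube n → ℝ)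
    (hg : ∀ x, g (x * Pi.mulSingle v (-1)) = -g x) : ∑ x, g x = 0 := by
  have h : ∑ x, g x = ∑ x, -g x :=
    (Fintype.sum_equiv (Equiv.mulRight (Pi.mulSingle v (-1) : Cube n)) _ _ fun x => by
      simp [hg])
  rw [Finset.sum_neg_distrib] at h
  linarith

lemma toReal_flip {n : ℕ} (x : Cube n) (v w : Fin n) :
    Cube.toReal (x * Pi.mulSingle v (-1)) w = if w = v then -x.toReal w else x.toReal w := by
  by_cases h : w = v
  · subst h; simp [Cube.toReal]
  · simp [Cube.toReal, h]

lemma character_flip_of_ne {n : ℕ} (x : Cube n) (v : Fin n) (i : Option (Fin n))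
    (hi : i ≠ some v) : character (x * Pi.mulSingle v (-1)) i = character x i := by
  cases i with
  | none => rfl
  | some w =>
    have : w ≠ v := fun h => hi (by rw [h])
    simp [toReal_flip, this]

lemma prod_toReal_flip {n : ℕ} (x : Cube n) (v : Fin n) (S : Finset (Fin n)) (hv : v ∈ S) :
    ∏ w ∈ S, Cube.toReal (x * Pi.mulSingle v (-1)) w = -∏ w ∈ S, x.toReal w := by
  rw [← Finset.mul_prod_erase _ _ hv, ← Finset.mul_prod_erase S (fun w => x.toReal w) hv,
    toReal_flip, if_pos rfl, neg_mul]
  congr 2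
  refine Finset.prod_congr rfl fun w hw => ?_
  rw [toReal_flip, if_neg (Finset.ne_of_mem_erase hw)]

/-- Orthogonality of characters: a monomial of degree four is orthogonal to every product of four
phases, except for those that query each of its variables once. -/
lemma sum_prod_mul_character {n : ℕ} (S : Finset (Fin n)) (hS : S.card = 4)
    (i j k l : Option (Fin n)) :
    ∑ x : Cube n, (∏ v ∈ S, x.toReal v) *
        (character x i * character x j * character x k * character x l) =
      if S.map .some = {i, j, k, l} then 2 ^ n else 0 := by
  split_ifs with h
  · have hc : ({i, j, k, l} : Finset (Option (Fin n))).card = 4 := by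
      rw [← h, Finset.card_map, hS]
    have key (x : Cube n) : ∏ v ∈ S, x.toReal v =
        character x i * character x j * character x k * character x l := by
      have : ∏ v ∈ S, x.toReal v = ∏ v ∈ S.map .some, character x v := by
        simp [Finset.prod_map]
      rw [this, h]
      rw [Finset.prod_insert, Finset.prod_insert, Finset.prod_insert, Finset.prod_singleton]
      · ring
      · intro hm
        rw [Finset.mem_singleton] at hm
        subst hm
        rw [Finset.pair_eq_singleton] at hc
        have := Finset.card_le_three (a := i) (b := j) (c := k)
        omega
      · intro hm
        rw [Finset.insert_eq_of_mem hm] at hc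
        have := Finset.card_le_three (a := i) (b := k) (c := l)
        omega
      · intro hm
        rw [Finset.insert_eq_of_mem hm] at hc
        have := Finset.card_le_three (a := j) (b := k) (c := l)
        omega
    have one (x : Cube n) : (∏ v ∈ S, x.toReal v) *
        (character x i * character x j * character x k * character x l) = 1 := by
      rw [← key, ← Finset.prod_mul_distrib]
      exact Finset.prod_eq_one fun v _ => toReal_mul_self x v
    simp [one]
  -- Some `v ∈ S` is not queried, and flipping the sign of `x v` flips the sign of the summand.
  · obtain ⟨v, hv, hn⟩ : ∃ v ∈ S, some v ∉ ({i, j, k, l} : Finset (Option (Fin n))) := by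
      by_contra! hcon
      refine h (Finset.eq_of_subset_of_card_le ?_ ?_)
      · intro a ha
        obtain ⟨v, hv, rfl⟩ := Finset.mem_map.1 ha
        exact hcon v hv
      · rw [Finset.card_map, hS]
        exact Finset.card_le_four
    simp only [Finset.mem_insert, Finset.mem_singleton, not_or] at hn
    refine sum_cube_eq_zero_of_flip v _ fun x => ?_
    rw [prod_toReal_flip x v S hv, character_flip_of_ne x v i (Ne.symm hn.1),
      character_flip_of_ne x v j (Ne.symm hn.2.1), character_flip_of_ne x v k (Ne.symm hn.2.2.1),
      character_flip_of_ne x v l (Ne.symm hn.2.2.2), neg_mul]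

/-- If four labels exhaust `insert z T`, then exactly one of them is `z` and the other three
exhaust `T`. -/
lemma insert_eq_four {α : Type*} [DecidableEq α] {z : α} {T : Finset α}
    (hz : z ∉ T) (hT : T.card = 3) (i j k l : α) (s : ℝ) :
    (if insert z T = {i, j, k, l} then s else 0) =
      (if i = z then if T = {j, k, l} then s else 0 else 0) +
      (if j = z then if T = {i, k, l} then s else 0 else 0) +
      (if k = z then if T = {l, i, j} then s else 0 else 0) +
      (if l = z then if T = {k, i, j} then s else 0 else 0) := by
  have e : insert z T = {i, j, k, l} ↔ (i = z ∧ T = {j, k, l}) ∨ (j = z ∧ T = {i, k, l}) ∨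
      (k = z ∧ T = {l, i, j}) ∨ (l = z ∧ T = {k, i, j}) := by
    constructor
    · intro h
      have hc : ({i, j, k, l} : Finset α).card = 4 := by
        rw [← h, Finset.card_insert_of_notMem hz, hT]
      have hT' : T = ({i, j, k, l} : Finset α).erase z := by rw [← h, Finset.erase_insert hz]
      have hm : z ∈ ({i, j, k, l} : Finset α) := h ▸ Finset.mem_insert_self z T
      have hsub (X : Finset α) (hX : X.card ≤ 3) (h' : T ⊆ X) : T = X :=
        Finset.eq_of_subset_of_card_le h' (by omega)
      simp only [Finset.mem_insert, Finset.mem_singleton] at hm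
      rcases hm with rfl | rfl | rfl | rfl
      · refine Or.inl ⟨rfl, hsub _ Finset.card_le_three ?_⟩
        rw [hT']; intro a; simp
      · refine Or.inr (Or.inl ⟨rfl, hsub _ Finset.card_le_three ?_⟩)
        rw [hT']; intro a; simp; tauto
      · refine Or.inr (Or.inr (Or.inl ⟨rfl, hsub _ Finset.card_le_three ?_⟩))
        rw [hT']; intro a; simp; tauto
      · refine Or.inr (Or.inr (Or.inr ⟨rfl, hsub _ Finset.card_le_three ?_⟩))
        rw [hT']; intro a; simp; tauto
    · rintro (⟨rfl, rfl⟩ | ⟨rfl, rfl⟩ | ⟨rfl, rfl⟩ | ⟨rfl, rfl⟩) <;> ext a <;> simp <;> tauto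
  have hz' {a b c : α} (h : T = {a, b, c}) : a ≠ z ∧ b ≠ z ∧ c ≠ z := by
    subst h; simp at hz; tauto
  simp only [e]
  clear e hT
  by_cases h1 : i = z ∧ T = {j, k, l}
  · have := hz' h1.2
    simp [h1.1, this, ← h1.2]
  by_cases h2 : j = z ∧ T = {i, k, l}
  · have := hz' h2.2
    simp [h2.1, this, ← h2.2]
  by_cases h3 : k = z ∧ T = {l, i, j}
  · have := hz' h3.2
    simp [h3.1, this, ← h3.2]
  by_cases h4 : l = z ∧ T = {k, i, j}
  · have := hz' h4.2
    simp [h4.1, this, ← h4.2]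
  simp [← ite_and, h1, h2, h3, h4]

/-- The four positions that `z` can take contribute equally: exchanging the two arguments of `b`
exchanges the positions `i, j` with `k, l`. -/
lemma sum_pairing_eq_two_mul {I E : Type*} [Fintype I] [DecidableEq I] [AddCommGroup E]
    [Module ℝ E] (b : E →ₗ[ℝ] E →ₗ[ℝ] ℝ) (hb : ∀ φ ψ, b φ ψ = b ψ φ) (z : I)
    (c : I → I → I → ℝ) (α : I → I → E) :
    ∑ i, ∑ j, ∑ k, ∑ l, ((if i = z then c j k l else 0) + (if j = z then c i k l else 0) +
        (if k = z then c l i j else 0) + (if l = z then c k i j else 0)) * b (α i j) (α k l) =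
      2 * ∑ j, b (α z j + α j z) (∑ k, ∑ l, c j k l • α k l) := by
  have first : ∑ i, ∑ j, ∑ k, ∑ l, ((if i = z then c j k l else 0) +
        (if j = z then c i k l else 0)) * b (α i j) (α k l) =
      ∑ j, b (α z j + α j z) (∑ k, ∑ l, c j k l • α k l) := by
    simp only [add_mul, ite_mul, zero_mul, Finset.sum_add_distrib, map_add, LinearMap.add_apply,
      map_sum, map_smul, smul_eq_mul, mul_add]
    congr 1
    · rw [Finset.sum_eq_single z]
      · simp
      · intro i _ hi; simp [hi]
      · simp
    · refine Finset.sum_congr rfl fun i _ => ?_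
      rw [Finset.sum_eq_single z]
      · simp
      · intro j _ hj; simp [hj]
      · simp
  have second : ∑ i, ∑ j, ∑ k, ∑ l, ((if k = z then c l i j else 0) +
        (if l = z then c k i j else 0)) * b (α i j) (α k l) =
      ∑ i, ∑ j, ∑ k, ∑ l, ((if i = z then c j k l else 0) +
        (if j = z then c i k l else 0)) * b (α i j) (α k l) := by
    have pairs (f : I → I → I → I → ℝ) : ∑ i, ∑ j, ∑ k, ∑ l, f i j k l =
        ∑ p : I × I, ∑ q : I × I, f p.1 p.2 q.1 q.2 := by
      simp only [Fintype.sum_prod_type]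
    rw [pairs, pairs, Finset.sum_comm]
    refine Finset.sum_congr rfl fun p _ => Finset.sum_congr rfl fun q _ => ?_
    rw [hb]
  rw [two_mul, ← first]
  nth_rewrite 2 [← second]
  simp only [← Finset.sum_add_distrib]
  refine Finset.sum_congr rfl fun i _ => Finset.sum_congr rfl fun j _ =>
      Finset.sum_congr rfl fun k _ => Finset.sum_congr rfl fun l _ => ?_
  ring

/-! ### Partial Steiner triple systems and their quartic forms -/

/-- A family of triples in `Fin n`, two distinct members of which share at most one vertex. -/
structure IsPartialSteinerTripleSystem {n : ℕ} {ι : Type*} (T : ι → Finset (Fin n)) : Prop where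
  card_eq : ∀ e, (T e).card = 3
  card_inter_le : ∀ e e', e ≠ e' → (T e ∩ T e').card ≤ 1

/-- Two vertices of an edge determine the edge and its third vertex. -/
lemma IsPartialSteinerTripleSystem.eq_of_pair {n : ℕ} {ι : Type*}
    {T : ι → Finset (Fin n)} (hT : IsPartialSteinerTripleSystem T)
    {e e' : ι} {j j' k l : Option (Fin n)} (h : (T e).map .some = {j, k, l})
    (h' : (T e').map .some = {j', k, l}) : e = e' ∧ j = j' := by
  have hkl {e : ι} {j : Option (Fin n)} (h : (T e).map .some = {j, k, l}) :
      k ≠ l ∧ j ≠ k ∧ j ≠ l := by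
    have hc : ({j, k, l} : Finset (Option (Fin n))).card = 3 := by
      rw [← h, Finset.card_map, hT.card_eq]
    have h2 (a b : Option (Fin n)) := Finset.card_le_two (a := a) (b := b)
    refine ⟨?_, ?_, ?_⟩ <;> rintro rfl <;> simp at hc <;> grind
  have he : e = e' := by
    by_contra hne
    have h1 := hT.card_inter_le e e' hne
    rw [← Finset.card_map .some, Finset.map_inter, h, h'] at h1
    have h2 : ({k, l} : Finset (Option (Fin n))) ⊆ {j, k, l} ∩ {j', k, l} := by
      intro a; simp; tauto
    have h3 := Finset.card_le_card h2
    rw [Finset.card_pair (hkl h).1] at h3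
    omega
  subst he
  refine ⟨rfl, ?_⟩
  have hj : j ∈ ({j', k, l} : Finset (Option (Fin n))) := by rw [← h', h]; simp
  have := hkl h
  simpa [this.2.1, this.2.2] using hj

section Hypergraph

variable {n : ℕ} {ι : Type*} [Fintype ι]

/-- The quartic form `x_z * ∑ e, σ e * ∏ v ∈ T e, x_v` as a function on the cube, written with the
monomials `insert z (T e)`. -/
def edgeForm (z : Fin n) (T : ι → Finset (Fin n)) (σ : ι → ℤˣ) (x : Cube n) : ℝ :=
  ∑ e, ((σ e : ℤ) : ℝ) * ∏ v ∈ insert z (T e), x.toReal v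

/-- The signed adjacency tensor of `T`: it is `σ e` if the labels `j, k, l` are the three vertices
of an edge `e`, in any order, and `0` if they are not the vertices of an edge. -/
def edgeCoeff (T : ι → Finset (Fin n)) (σ : ι → ℤˣ) (j k l : Option (Fin n)) : ℝ :=
  ∑ e, if (T e).map .some = {j, k, l} then ((σ e : ℤ) : ℝ) else 0

lemma edgeCoeff_comm (T : ι → Finset (Fin n)) (σ : ι → ℤˣ) (j k l : Option (Fin n)) :
    edgeCoeff T σ j k l = edgeCoeff T σ k j l := by
  simp only [edgeCoeff, Finset.insert_comm]

lemma sum_edgeForm_mul_character {z : Fin n} {T : ι → Finset (Fin n)} (σ : ι → ℤˣ)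
    (hT : IsPartialSteinerTripleSystem T) (hz : ∀ e, z ∉ T e) (i j k l : Option (Fin n)) :
    ∑ x : Cube n, edgeForm z T σ x *
        ((character x i * character x j) * (character x k * character x l)) =
      2 ^ n * ((if i = some z then edgeCoeff T σ j k l else 0) +
        (if j = some z then edgeCoeff T σ i k l else 0) +
        (if k = some z then edgeCoeff T σ l i j else 0) +
        (if l = some z then edgeCoeff T σ k i j else 0)) := by
  have h (e : ι) : (if (insert z (T e)).map .some = {i, j, k, l} then ((σ e : ℤ) : ℝ) else 0) = _ :=
    Finset.map_insert (.some : Fin n ↪ Option (Fin n)) z (T e) ▸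
    insert_eq_four (z := some z) (T := (T e).map .some) (by simpa using hz e)
      (by rw [Finset.card_map, hT.card_eq]) i j k l ((σ e : ℤ) : ℝ)
  have h' (e : ι) : ∑ x : Cube n, (((σ e : ℤ) : ℝ) * ∏ v ∈ insert z (T e), x.toReal v) *
        ((character x i * character x j) * (character x k * character x l)) =
      2 ^ n * (if (insert z (T e)).map .some = {i, j, k, l} then ((σ e : ℤ) : ℝ) else 0) := by
    have := sum_prod_mul_character (insert z (T e))
      (by rw [Finset.card_insert_of_notMem (hz e), hT.card_eq]) i j k l
    simp only [← mul_assoc] at this ⊢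
    simp only [mul_assoc ((σ e : ℤ) : ℝ), ← Finset.mul_sum, this]
    split_ifs <;> ring
  simp only [edgeForm, Finset.sum_mul]
  rw [Finset.sum_comm]
  simp only [h', h, ← Finset.mul_sum, Finset.sum_add_distrib, edgeCoeff]
  congr 1
  split_ifs <;> simp

/-- Pairing `edgeForm` with a quadratic form `b` in a state of degree two: what is left pairs the
coefficients at `z` and `j` with the signed sum of the coefficients that complete `j` to an edge. -/
lemma sum_edgeForm_mul_bilin {E : Type*} [AddCommGroup E] [Module ℝ E]
    {z : Fin n} {T : ι → Finset (Fin n)} (σ : ι → ℤˣ)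
    (hT : IsPartialSteinerTripleSystem T) (hz : ∀ e, z ∉ T e) (b : E →ₗ[ℝ] E →ₗ[ℝ] ℝ)
    (hb : ∀ φ ψ, b φ ψ = b ψ φ) (α : Option (Fin n) → Option (Fin n) → E) :
    ∑ x : Cube n, edgeForm z T σ x *
        b (∑ k, ∑ l, (character x k * character x l) • α k l)
          (∑ k, ∑ l, (character x k * character x l) • α k l) =
      2 ^ n * (2 * ∑ j, b (α (some z) j + α j (some z))
        (∑ k, ∑ l, edgeCoeff T σ j k l • α k l)) := by
  have expand (x : Cube n) : edgeForm z T σ x *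
        b (∑ k, ∑ l, (character x k * character x l) • α k l)
          (∑ k, ∑ l, (character x k * character x l) • α k l) =
      ∑ i, ∑ j, ∑ k, ∑ l, edgeForm z T σ x *
        ((character x i * character x j) * (character x k * character x l)) *
          b (α i j) (α k l) := by
    simp only [map_sum, map_smul, LinearMap.sum_apply, LinearMap.smul_apply, smul_eq_mul,
      Finset.mul_sum]
    refine Finset.sum_congr rfl fun i _ => Finset.sum_congr rfl fun j _ =>
      Finset.sum_congr rfl fun k _ => Finset.sum_congr rfl fun l _ => ?_
    rw [hb (α k l)]
    ring
  have swap : ∑ x : Cube n, ∑ i, ∑ j, ∑ k, ∑ l, edgeForm z T σ x *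
        ((character x i * character x j) * (character x k * character x l)) *
          b (α i j) (α k l) =
      ∑ i, ∑ j, ∑ k, ∑ l, (∑ x : Cube n, edgeForm z T σ x *
        ((character x i * character x j) * (character x k * character x l))) *
          b (α i j) (α k l) := by
    rw [Finset.sum_comm]
    refine Finset.sum_congr rfl fun i _ => ?_
    rw [Finset.sum_comm]
    refine Finset.sum_congr rfl fun j _ => ?_
    rw [Finset.sum_comm]
    refine Finset.sum_congr rfl fun k _ => ?_
    rw [Finset.sum_comm]
    refine Finset.sum_congr rfl fun l _ => ?_
    rw [Finset.sum_mul]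
  simp only [expand]
  rw [swap, ← sum_pairing_eq_two_mul b hb]
  simp only [sum_edgeForm_mul_character σ hT hz]
  simp only [mul_assoc, ← Finset.mul_sum]

lemma edgeCoeff_sq_le_one {T : ι → Finset (Fin n)}
    (hT : IsPartialSteinerTripleSystem T) (σ : ι → ℤˣ) (j k l : Option (Fin n)) :
    edgeCoeff T σ j k l ^ 2 ≤ 1 := by
  by_cases h : ∃ e, (T e).map .some = {j, k, l}
  · obtain ⟨e, he⟩ := h
    have : edgeCoeff T σ j k l = ((σ e : ℤ) : ℝ) := by
      rw [edgeCoeff, Finset.sum_eq_single e]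
      · simp [he]
      · intro e' _ hne
        rw [if_neg fun h' => hne (hT.eq_of_pair h' he).1]
      · simp
    rw [this]
    rcases Int.units_eq_one_or (σ e) with h | h <;> simp [h]
  · push Not at h
    simp [edgeCoeff, h]

lemma eq_of_edgeCoeff_ne_zero {T : ι → Finset (Fin n)}
    (hT : IsPartialSteinerTripleSystem T) (σ : ι → ℤˣ) {j j' k l : Option (Fin n)}
    (h : edgeCoeff T σ j k l ≠ 0) (h' : edgeCoeff T σ j' k l ≠ 0) : j = j' := by
  have ex {j : Option (Fin n)} (h : edgeCoeff T σ j k l ≠ 0) :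
      ∃ e, (T e).map .some = {j, k, l} := by
    obtain ⟨e, -, he⟩ := Finset.exists_ne_zero_of_sum_ne_zero h
    exact ⟨e, by_contra fun hn => he (if_neg hn)⟩
  obtain ⟨e, he⟩ := ex h
  obtain ⟨e', he'⟩ := ex h'
  exact (hT.eq_of_pair he he').2

/-- Each pair `k, l` is completed to an edge by at most one `j`. -/
lemma sum_edgeCoeff_sq_le_one {T : ι → Finset (Fin n)}
    (hT : IsPartialSteinerTripleSystem T) (σ : ι → ℤˣ) (k l : Option (Fin n)) :
    ∑ j, edgeCoeff T σ j k l ^ 2 ≤ 1 := by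
  by_cases h : ∃ j, edgeCoeff T σ j k l ≠ 0
  · obtain ⟨j, hj⟩ := h
    rw [Finset.sum_eq_single j]
    · exact edgeCoeff_sq_le_one hT σ j k l
    · intro j' _ hne
      by_contra hn
      exact hne (eq_of_edgeCoeff_ne_zero hT σ (fun h0 => hn (by simp [h0])) hj)
    · simp
  · push Not at h
    simp [h]

/-- The sum has at most one nonzero term, as `j, l` are completed to an edge by at most one `k`. -/
lemma normSq_sum_edgeCoeff_le {T : ι → Finset (Fin n)}
    (hT : IsPartialSteinerTripleSystem T) (σ : ι → ℤˣ) (j l : Option (Fin n))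
    (β : Option (Fin n) → ℂ) :
    Complex.normSq (∑ k, edgeCoeff T σ j k l • β k) ≤
      ∑ k, edgeCoeff T σ j k l ^ 2 * Complex.normSq (β k) := by
  by_cases h : ∃ k, edgeCoeff T σ j k l ≠ 0
  · obtain ⟨k, hk⟩ := h
    rw [Finset.sum_eq_single k]
    · refine le_trans (le_of_eq ?_) (Finset.single_le_sum
        (f := fun k => edgeCoeff T σ j k l ^ 2 * Complex.normSq (β k))
        (fun k _ => mul_nonneg (sq_nonneg _) (Complex.normSq_nonneg _)) (Finset.mem_univ k))
      rw [Complex.real_smul, Complex.normSq_mul, Complex.normSq_ofReal, sq]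
    · intro k' _ hne
      have : edgeCoeff T σ j k' l = 0 := by
        by_contra hn
        rw [edgeCoeff_comm] at hn hk
        exact hne (eq_of_edgeCoeff_ne_zero hT σ hn hk)
      simp [this]
    · simp
  · push Not at h
    simp [h]

end Hypergraph

/-! ### Positive semidefinite quadratic forms -/

section QuadraticForms

variable {R : Type*} [Fintype R]

/-- The squared Euclidean norm of a complex vector (the norm instance of `R → ℂ` is the
supremum norm). -/
def normSqVec (ψ : R → ℂ) : ℝ := ∑ r, Complex.normSq (ψ r)

lemma star_dotProduct_self (ψ : R → ℂ) : star ψ ⬝ᵥ ψ = (normSqVec ψ : ℂ) := by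
  simp [dotProduct, normSqVec, Complex.normSq_eq_conj_mul_self]

lemma normSqVec_unitary_mulVec [DecidableEq R] (U : Matrix.unitaryGroup R ℂ) (ψ : R → ℂ) :
    normSqVec (U.1 *ᵥ ψ) = normSqVec ψ := by
  have h : star (U.1 *ᵥ ψ) ⬝ᵥ (U.1 *ᵥ ψ) = star ψ ⬝ᵥ ψ := by
    rw [Matrix.star_mulVec, Matrix.dotProduct_mulVec, Matrix.vecMul_vecMul,
      ← Matrix.star_eq_conjTranspose, Matrix.UnitaryGroup.star_mul_self, Matrix.vecMul_one]
  rw [star_dotProduct_self, star_dotProduct_self] at h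
  exact_mod_cast h

/-- The real part of the sesquilinear form of `E`, as a real bilinear form. -/
noncomputable def reForm (E : Matrix R R ℂ) : (R → ℂ) →ₗ[ℝ] (R → ℂ) →ₗ[ℝ] ℝ :=
  LinearMap.mk₂ ℝ (fun φ ψ => (star φ ⬝ᵥ (E *ᵥ ψ)).re)
    (fun φ φ' ψ => by simp [add_dotProduct])
    (fun c φ ψ => by
      rw [star_smul, smul_dotProduct, star_trivial, Complex.smul_re])
    (fun φ ψ ψ' => by simp [Matrix.mulVec_add])
    (fun c φ ψ => by
      rw [Matrix.mulVec_smul, dotProduct_smul, Complex.smul_re])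

lemma reForm_apply (E : Matrix R R ℂ) (φ ψ : R → ℂ) :
    reForm E φ ψ = (star φ ⬝ᵥ (E *ᵥ ψ)).re := rfl

lemma reForm_comm {E : Matrix R R ℂ} (hE : E.IsHermitian) (φ ψ : R → ℂ) :
    reForm E φ ψ = reForm E ψ φ := by
  rw [reForm_apply, reForm_apply]
  have : star ψ ⬝ᵥ (E *ᵥ φ) = star (star φ ⬝ᵥ (E *ᵥ ψ)) := by
    rw [Matrix.star_dotProduct, Matrix.star_mulVec, hE.eq, ← Matrix.dotProduct_mulVec]
  rw [this]
  simp

lemma reForm_self_nonneg {E : Matrix R R ℂ} (hE : E.PosSemidef) (φ : R → ℂ) :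
    0 ≤ reForm E φ φ := by
  exact hE.re_dotProduct_nonneg φ

/-- The form is nonnegative at `φ + ψ` and at `φ - ψ`. -/
lemma two_mul_abs_reForm_le {E : Matrix R R ℂ} (hE : E.PosSemidef) (φ ψ : R → ℂ) :
    2 * |reForm E φ ψ| ≤ reForm E φ φ + reForm E ψ ψ := by
  have h1 := reForm_self_nonneg hE (φ + ψ)
  have h2 := reForm_self_nonneg hE (φ - ψ)
  simp only [map_add, map_sub, LinearMap.add_apply, LinearMap.sub_apply,
    reForm_comm hE.1 ψ φ] at h1 h2
  rcases abs_cases (reForm E φ ψ) with ⟨h, -⟩ | ⟨h, -⟩ <;> rw [h] <;> linarith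

end QuadraticForms

/-! ### Two-query algorithms -/

section Paths

variable {n : ℕ}

namespace Algorithm

/-- The state just before the second query, restricted to the branch in which the first query was
at `k`, without the phase. -/
def amplitude (A : Algorithm n 2) (k : Option (Fin n)) : Reg n A.d → ℂ :=
  (A.U 1).1 *ᵥ fun r => if r.1 = k then ((A.U 0).1 *ᵥ A.init) r else 0

/-- The state just after the second query, restricted to the branch that queries `k` first and `l`
second, without the phases. -/
def path (A : Algorithm n 2) (k l : Option (Fin n)) : Reg n A.d → ℂ :=
  fun r => if r.1 = l then A.amplitude k r else 0

lemma finalState_eq (A : Algorithm n 2) (x : Cube n) :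
    A.finalState x = (A.U 2).1 *ᵥ ∑ k, ∑ l, (character x k * character x l) • A.path k l := by
  have h0 : oracle A.d x *ᵥ ((A.U 0).1 *ᵥ A.init) = ∑ k, (character x k : ℂ) •
      fun r : Reg n A.d => if r.1 = k then ((A.U 0).1 *ᵥ A.init) r else 0 := by
    ext r
    rw [oracle, Matrix.mulVec_diagonal, phase_eq_character, Finset.sum_apply]
    simp [-Fintype.sum_option]
  have h1 : (A.U 1).1 *ᵥ (oracle A.d x *ᵥ ((A.U 0).1 *ᵥ A.init)) =
      ∑ k, (character x k : ℂ) • A.amplitude k := by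
    rw [h0, Matrix.mulVec_sum]
    simp only [Matrix.mulVec_smul, amplitude]
  have h2 : oracle A.d x *ᵥ ((A.U 1).1 *ᵥ (oracle A.d x *ᵥ ((A.U 0).1 *ᵥ A.init))) =
      ∑ k, ∑ l, (character x k * character x l) • A.path k l := by
    rw [h1]
    ext r
    rw [oracle, Matrix.mulVec_diagonal, phase_eq_character]
    simp only [Finset.sum_apply, Pi.smul_apply, path, smul_ite, smul_zero, Finset.sum_ite_eq,
      Finset.mem_univ, if_true, Finset.mul_sum, Complex.real_smul, smul_eq_mul]
    refine Finset.sum_congr rfl fun k _ => ?_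
    push_cast
    ring
  rw [← h2]
  rfl

lemma sum_normSqVec_amplitude (A : Algorithm n 2) : ∑ k, normSqVec (A.amplitude k) = 1 := by
  have h : normSqVec A.init = 1 := by
    have := A.init_unit
    rw [star_dotProduct_self] at this
    exact_mod_cast this
  have e (k : Option (Fin n)) : normSqVec (A.amplitude k) = ∑ r : Reg n A.d,
      if r.1 = k then Complex.normSq (((A.U 0).1 *ᵥ A.init) r) else 0 := by
    rw [amplitude, normSqVec_unitary_mulVec, normSqVec]
    simp only [apply_ite Complex.normSq, map_zero]
  calc ∑ k, normSqVec (A.amplitude k) = normSqVec ((A.U 0).1 *ᵥ A.init) := by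
        rw [Finset.sum_congr rfl fun k _ => e k, Finset.sum_comm]
        simp only [Finset.sum_ite_eq, Finset.mem_univ, if_true]
        rfl
    _ = 1 := by rw [normSqVec_unitary_mulVec, h]

lemma normSqVec_amplitude_le (A : Algorithm n 2) (k : Option (Fin n)) :
    normSqVec (A.amplitude k) ≤ 1 := by
  rw [← A.sum_normSqVec_amplitude]
  exact Finset.single_le_sum (f := fun k => normSqVec (A.amplitude k))
    (fun k _ => Finset.sum_nonneg fun r _ => Complex.normSq_nonneg _) (Finset.mem_univ k)

/-- The effect of the outcome `s`, pulled back along the last unitary. -/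
def pulledEffect (A : Algorithm n 2) (s : ℤˣ) : Matrix (Reg n A.d) (Reg n A.d) ℂ :=
  (A.U 2).1ᴴ * A.effect s * (A.U 2).1

lemma pulledEffect_posSemidef (A : Algorithm n 2) (s : ℤˣ) : (A.pulledEffect s).PosSemidef :=
  (A.effect_posSemidef s).conjTranspose_mul_mul_same _

lemma prob_eq (A : Algorithm n 2) (x : Cube n) (s : ℤˣ) :
    A.prob x s = reForm (A.pulledEffect s)
      (∑ k, ∑ l, (character x k * character x l) • A.path k l)
      (∑ k, ∑ l, (character x k * character x l) • A.path k l) := by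
  rw [prob, finalState_eq, reForm_apply, pulledEffect, Matrix.star_mulVec,
    ← Matrix.dotProduct_mulVec, Matrix.mulVec_mulVec, Matrix.mulVec_mulVec, Matrix.mul_assoc]

lemma sum_reForm_pulledEffect (A : Algorithm n 2) (ψ : Reg n A.d → ℂ) :
    ∑ s, reForm (A.pulledEffect s) ψ ψ = normSqVec ψ := by
  have h : ∑ s, A.pulledEffect s = 1 := by
    simp only [pulledEffect, ← Finset.mul_sum, ← Finset.sum_mul, A.effect_sum, mul_one]
    rw [← Matrix.star_eq_conjTranspose, Matrix.UnitaryGroup.star_mul_self]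
  simp only [reForm_apply]
  rw [← Complex.re_sum, ← dotProduct_sum, ← Matrix.sum_mulVec, h, Matrix.one_mulVec,
    star_dotProduct_self, Complex.ofReal_re]

end Algorithm

variable {ι : Type*} [Fintype ι]

/-- Crude form of the orthogonality of branches: by `‖u + v‖² ≤ 2 ‖u‖² + 2 ‖v‖²` each of the
families `path z j` and `path j z` contributes at most `2`. -/
lemma sum_normSqVec_path_add_le (A : Algorithm n 2) (z : Option (Fin n)) :
    ∑ j, normSqVec (A.path z j + A.path j z) ≤ 4 := by
  have h (j : Option (Fin n)) (r : Reg n A.d) :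
      Complex.normSq ((A.path z j + A.path j z) r) ≤
      2 * (if r.1 = j then Complex.normSq (A.amplitude z r) else 0) +
        2 * Complex.normSq (A.amplitude j r) := by
    have h1 : Complex.normSq (A.path j z r) ≤ Complex.normSq (A.amplitude j r) := by
      rw [Algorithm.path]
      split_ifs
      · exact le_rfl
      · simpa using Complex.normSq_nonneg _
    have h2 : Complex.normSq (A.path z j r) =
        if r.1 = j then Complex.normSq (A.amplitude z r) else 0 := by
      rw [Algorithm.path, apply_ite Complex.normSq, map_zero]
    have h3 (u v : ℂ) : Complex.normSq (u + v) ≤ 2 * Complex.normSq u + 2 * Complex.normSq v := by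
      simp only [Complex.normSq_apply, Complex.add_re, Complex.add_im]
      nlinarith [sq_nonneg (u.re - v.re), sq_nonneg (u.im - v.im)]
    have := h3 (A.path z j r) (A.path j z r)
    rw [Pi.add_apply]
    linarith
  calc ∑ j, normSqVec (A.path z j + A.path j z)
      ≤ ∑ j, ∑ r : Reg n A.d, (2 * (if r.1 = j then Complex.normSq (A.amplitude z r) else 0) +
          2 * Complex.normSq (A.amplitude j r)) :=
        Finset.sum_le_sum fun j _ => Finset.sum_le_sum fun r _ => h j r
    _ = 2 * normSqVec (A.amplitude z) + 2 * ∑ j, normSqVec (A.amplitude j) := by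
        simp only [Finset.sum_add_distrib, ← Finset.mul_sum]
        congr 2
        rw [Finset.sum_comm]
        simp only [Finset.sum_ite_eq, Finset.mem_univ, if_true]
        rfl
    _ ≤ 4 := by
        rw [A.sum_normSqVec_amplitude]
        linarith [A.normSqVec_amplitude_le z]

/-- The paths `k, l` that complete a fixed `j` to an edge are orthogonal: those with distinct `l`
live on distinct labels of the query register, and `l` determines `k`. Each path is counted for at
most one `j`. -/
lemma sum_normSqVec_edgeCoeff_path_le (A : Algorithm n 2) {T : ι → Finset (Fin n)}
    (hT : IsPartialSteinerTripleSystem T) (σ : ι → ℤˣ) :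
    ∑ j, normSqVec (∑ k, ∑ l, edgeCoeff T σ j k l • A.path k l) ≤ 1 := by
  have h (j : Option (Fin n)) (r : Reg n A.d) :
      Complex.normSq ((∑ k, ∑ l, edgeCoeff T σ j k l • A.path k l) r) ≤
      ∑ k, edgeCoeff T σ j k r.1 ^ 2 * Complex.normSq (A.amplitude k r) := by
    refine le_trans (le_of_eq ?_) (normSq_sum_edgeCoeff_le hT σ j r.1 fun k => A.amplitude k r)
    simp only [Finset.sum_apply, Pi.smul_apply, Algorithm.path, smul_ite, smul_zero,
      Finset.sum_ite_eq, Finset.mem_univ, if_true]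
  calc ∑ j, normSqVec (∑ k, ∑ l, edgeCoeff T σ j k l • A.path k l)
      ≤ ∑ j, ∑ r : Reg n A.d, ∑ k, edgeCoeff T σ j k r.1 ^ 2 * Complex.normSq (A.amplitude k r) :=
        Finset.sum_le_sum fun j _ => Finset.sum_le_sum fun r _ => h j r
    _ = ∑ k, ∑ r : Reg n A.d, (∑ j, edgeCoeff T σ j k r.1 ^ 2) *
          Complex.normSq (A.amplitude k r) := by
        simp only [Finset.sum_mul]
        rw [Finset.sum_comm, Finset.sum_comm (s := (Finset.univ : Finset (Option (Fin n))))]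
        refine Finset.sum_congr rfl fun r _ => ?_
        rw [Finset.sum_comm]
    _ ≤ ∑ k, ∑ r : Reg n A.d, Complex.normSq (A.amplitude k r) := by
        refine Finset.sum_le_sum fun k _ => Finset.sum_le_sum fun r _ => ?_
        exact mul_le_of_le_one_left (Complex.normSq_nonneg _) (sum_edgeCoeff_sq_le_one hT σ k r.1)
    _ = 1 := A.sum_normSqVec_amplitude

/-- Two-query algorithms have bounded correlation with `edgeForm`, whereas the correlation of
`edgeForm` with itself is `2 ^ n` times the number of edges. -/
lemma abs_sum_edgeForm_mul_expectation_le (A : Algorithm n 2) {z : Fin n}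
    {T : ι → Finset (Fin n)} (hT : IsPartialSteinerTripleSystem T) (hz : ∀ e, z ∉ T e)
    (σ : ι → ℤˣ) : |∑ x, edgeForm z T σ x * A.expectation x| ≤ 5 * 2 ^ n := by
  set P : Option (Fin n) → Reg n A.d → ℂ := fun j => A.path (some z) j + A.path j (some z)
  set Q : Option (Fin n) → Reg n A.d → ℂ :=
    fun j => ∑ k, ∑ l, edgeCoeff T σ j k l • A.path k l
  have key : ∑ x, edgeForm z T σ x * A.expectation x =
      2 ^ n * ∑ j, ∑ s : ℤˣ, ((s : ℤ) : ℝ) * (2 * reForm (A.pulledEffect s) (P j) (Q j)) := by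
    have h (s : ℤˣ) := sum_edgeForm_mul_bilin σ hT hz (reForm (A.pulledEffect s))
      (reForm_comm (A.pulledEffect_posSemidef s).1) A.path
    simp only [← Algorithm.prob_eq] at h
    simp only [Algorithm.expectation, Finset.mul_sum]
    rw [Finset.sum_comm, Finset.sum_comm (s := (Finset.univ : Finset (Option (Fin n))))]
    refine Finset.sum_congr rfl fun s _ => ?_
    simp only [mul_left_comm _ (((s : ℤ) : ℝ)), ← Finset.mul_sum, h s]
    rfl
  have bound (j : Option (Fin n)) :
      |∑ s : ℤˣ, ((s : ℤ) : ℝ) * (2 * reForm (A.pulledEffect s) (P j) (Q j))| ≤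
        normSqVec (P j) + normSqVec (Q j) := by
    rw [← A.sum_reForm_pulledEffect, ← A.sum_reForm_pulledEffect, ← Finset.sum_add_distrib]
    refine (Finset.abs_sum_le_sum_abs _ _).trans (Finset.sum_le_sum fun s _ => ?_)
    have hs : |((s : ℤ) : ℝ)| = 1 := by
      rcases Int.units_eq_one_or s with h | h <;> simp [h]
    rw [abs_mul, hs, one_mul, abs_mul, abs_two]
    exact two_mul_abs_reForm_le (A.pulledEffect_posSemidef s) _ _
  rw [key, abs_mul, abs_of_pos (by positivity : (0 : ℝ) < 2 ^ n), mul_comm]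
  refine mul_le_mul_of_nonneg_right ?_ (by positivity)
  refine (Finset.abs_sum_le_sum_abs _ _).trans ((Finset.sum_le_sum fun j _ => bound j).trans ?_)
  rw [Finset.sum_add_distrib]
  have h1 := sum_normSqVec_path_add_le A (some z)
  have h2 := sum_normSqVec_edgeCoeff_path_le A hT σ
  linarith
end Paths

/-! ### Random signs -/

/-- Hoeffding's inequality and a union bound over `Y`, in the form of an averaging argument over
all sign vectors. -/
lemma exists_signs_forall_sum_le {ι Y : Type*} [Fintype ι] [DecidableEq ι] [Fintype Y]
    [Nonempty Y] (w : Y → ι → ℝ) (hw : ∀ y i, |w y i| ≤ 1) {lam : ℝ} (hlam : 0 < lam) :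
    ∃ σ : ι → ℤˣ, ∀ y, ∑ i, ((σ i : ℤ) : ℝ) * w y i ≤
      Real.log (Fintype.card Y) / lam + lam * Fintype.card ι / 2 := by
  set K : ℝ := Fintype.card Y * Real.exp (lam ^ 2 / 2 * Fintype.card ι) with hK
  have hY : (0 : ℝ) < Fintype.card Y := by exact_mod_cast Fintype.card_pos
  have moment (y : Y) : ∑ σ : ι → ℤˣ, Real.exp (lam * ∑ i, ((σ i : ℤ) : ℝ) * w y i) ≤
      2 ^ Fintype.card ι * Real.exp (lam ^ 2 / 2 * Fintype.card ι) := by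
    have h1 : ∑ σ : ι → ℤˣ, Real.exp (lam * ∑ i, ((σ i : ℤ) : ℝ) * w y i) =
        ∏ i, ∑ s : ℤˣ, Real.exp (lam * (((s : ℤ) : ℝ) * w y i)) := by
      rw [Fintype.prod_sum]
      simp_rw [Finset.mul_sum, Real.exp_sum]
    have h2 (i : ι) : ∑ s : ℤˣ, Real.exp (lam * (((s : ℤ) : ℝ) * w y i)) ≤
        2 * Real.exp (lam ^ 2 / 2) := by
      have e : ∑ s : ℤˣ, Real.exp (lam * (((s : ℤ) : ℝ) * w y i)) =
          2 * Real.cosh (lam * w y i) := by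
        rw [Real.cosh_eq]
        simp [UnitsInt.univ]
        ring
      rw [e]
      have : (lam * w y i) ^ 2 ≤ lam ^ 2 := by
        rw [mul_pow]
        have := (sq_le_one_iff_abs_le_one (w y i)).2 (hw y i)
        nlinarith [sq_nonneg lam]
      have := (Real.cosh_le_exp_half_sq (lam * w y i)).trans
        (Real.exp_le_exp.2 (by linarith : (lam * w y i) ^ 2 / 2 ≤ lam ^ 2 / 2))
      linarith
    rw [h1]
    refine (Finset.prod_le_prod (fun i _ => by positivity) fun i _ => h2 i).trans ?_
    rw [Finset.prod_const, Finset.card_univ, mul_pow, ← Real.exp_nat_mul, mul_comm (lam ^ 2 / 2)]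
  obtain ⟨σ, -, hσ⟩ : ∃ σ ∈ (Finset.univ : Finset (ι → ℤˣ)),
      ∑ y, Real.exp (lam * ∑ i, ((σ i : ℤ) : ℝ) * w y i) ≤ K := by
    refine Finset.exists_le_of_sum_le Finset.univ_nonempty ?_
    rw [Finset.sum_comm]
    refine (Finset.sum_le_sum fun y _ => moment y).trans (le_of_eq ?_)
    simp [hK]
    ring
  refine ⟨σ, fun y => ?_⟩
  have h3 := (Finset.single_le_sum (f := fun y => Real.exp (lam * ∑ i, ((σ i : ℤ) : ℝ) * w y i))
    (fun y _ => (Real.exp_pos _).le) (Finset.mem_univ y)).trans hσ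
  have h4 := Real.log_le_log (Real.exp_pos _) h3
  rw [Real.log_exp, hK, Real.log_mul hY.ne' (Real.exp_pos _).ne', Real.log_exp] at h4
  rw [← mul_le_mul_iff_of_pos_left hlam]
  refine h4.trans (le_of_eq ?_)
  field_simp

/-! ### The quartic polynomial -/

section Polynomial

variable {n : ℕ} {ι : Type*} [Fintype ι]

/-- The polynomial whose restriction to the cube is `edgeForm`. -/
noncomputable def edgePolynomial (z : Fin n) (T : ι → Finset (Fin n)) (σ : ι → ℤˣ) :
    MvPolynomial (Fin n) ℝ :=
  ∑ e, MvPolynomial.C ((σ e : ℤ) : ℝ) * ∏ v ∈ insert z (T e), MvPolynomial.X v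

lemma eval_edgePolynomial (z : Fin n) (T : ι → Finset (Fin n)) (σ : ι → ℤˣ) (x : Cube n) :
    MvPolynomial.eval x.toReal (edgePolynomial z T σ) = edgeForm z T σ x := by
  simp [edgePolynomial, edgeForm]

lemma isHomogeneous_edgePolynomial {z : Fin n} {T : ι → Finset (Fin n)}
    (hT : IsPartialSteinerTripleSystem T) (hz : ∀ e, z ∉ T e) (σ : ι → ℤˣ) :
    (edgePolynomial z T σ).IsHomogeneous 4 := by
  refine MvPolynomial.IsHomogeneous.sum _ _ _ fun e _ => ?_
  have h := MvPolynomial.IsHomogeneous.prod (insert z (T e))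
    (fun v => (MvPolynomial.X v : MvPolynomial (Fin n) ℝ)) (fun _ => 1)
    fun v _ => MvPolynomial.isHomogeneous_X ℝ v
  rw [Finset.sum_const, Finset.card_insert_of_notMem (hz e), hT.card_eq] at h
  exact h.C_mul _

lemma sum_edgeForm_mul_edge {z : Fin n} {T : ι → Finset (Fin n)}
    (hT : IsPartialSteinerTripleSystem T) (hz : ∀ e, z ∉ T e) (σ : ι → ℤˣ) (e : ι) :
    ∑ x : Cube n, edgeForm z T σ x * ∏ v ∈ insert z (T e), x.toReal v =
      2 ^ n * ((σ e : ℤ) : ℝ) := by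
  obtain ⟨j, k, l, hjk, hjl, hkl, he⟩ := Finset.card_eq_three.1 (hT.card_eq e)
  have hze := hz e
  simp only [he, Finset.mem_insert, Finset.mem_singleton, not_or] at hze
  have hprod (x : Cube n) : ∏ v ∈ insert z (T e), x.toReal v =
      (character x (some z) * character x (some j)) *
        (character x (some k) * character x (some l)) := by
    rw [Finset.prod_insert (hz e), he, Finset.prod_insert (by simp [hjk, hjl]),
      Finset.prod_insert (by simp [hkl]), Finset.prod_singleton]
    simp only [character_some]
    ring
  simp only [hprod, sum_edgeForm_mul_character σ hT hz, if_true, Option.some.injEq,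
    Ne.symm hze.1, Ne.symm hze.2.1, Ne.symm hze.2.2, if_false, add_zero]
  have hmap : (T e).map .some = {some j, some k, some l} := by rw [he]; simp
  rw [edgeCoeff, Finset.sum_eq_single e]
  · rw [if_pos hmap]
  · exact fun e' _ hne => if_neg fun h => hne (hT.eq_of_pair h hmap).1
  · simp

lemma sum_edgeForm_sq {z : Fin n} {T : ι → Finset (Fin n)}
    (hT : IsPartialSteinerTripleSystem T) (hz : ∀ e, z ∉ T e) (σ : ι → ℤˣ) :
    ∑ x : Cube n, edgeForm z T σ x ^ 2 = 2 ^ n * Fintype.card ι := by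
  have h (x : Cube n) : edgeForm z T σ x ^ 2 = ∑ e, ((σ e : ℤ) : ℝ) *
      (edgeForm z T σ x * ∏ v ∈ insert z (T e), x.toReal v) := by
    rw [sq]
    nth_rewrite 2 [edgeForm]
    rw [Finset.mul_sum]
    exact Finset.sum_congr rfl fun e _ => by ring
  have hσ (e : ι) : ((σ e : ℤ) : ℝ) * (2 ^ n * ((σ e : ℤ) : ℝ)) = 2 ^ n := by
    rcases Int.units_eq_one_or (σ e) with h | h <;> simp [h]
  simp only [h]
  rw [Finset.sum_comm]
  simp only [← Finset.mul_sum, sum_edgeForm_mul_edge hT hz, hσ]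
  simp [mul_comm]

/-- The union bound is over the `2 ^ (n + 1)` pairs of a point of the cube and a sign; the sign
turns the upper bound into a bound on the absolute value. -/
lemma exists_signs_abs_edgeForm_le (z : Fin n) (T : ι → Finset (Fin n)) {lam : ℝ}
    (hlam : 0 < lam) : ∃ σ : ι → ℤˣ, ∀ x,
      |edgeForm z T σ x| ≤ (n + 1) / lam + lam * Fintype.card ι / 2 := by
  classical
  obtain ⟨σ, hσ⟩ := exists_signs_forall_sum_le
    (fun (y : ℤˣ × Cube n) e => ((y.1 : ℤ) : ℝ) * ∏ v ∈ insert z (T e), y.2.toReal v)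
    (fun y e => by
      have h1 : |((y.1 : ℤ) : ℝ)| = 1 := by
        rcases Int.units_eq_one_or y.1 with h | h <;> simp [h]
      have h2 (v : Fin n) : |y.2.toReal v| = 1 := by
        rcases Int.units_eq_one_or (y.2 v) with h | h <;> simp [Cube.toReal, h]
      rw [abs_mul, h1, Finset.abs_prod]
      simp [h2]) hlam
  have hcard : Real.log (Fintype.card (ℤˣ × Cube n)) ≤ n + 1 := by
    have : (Fintype.card (ℤˣ × Cube n) : ℝ) = 2 ^ (n + 1) := by
      simp [pow_succ, mul_comm]
    rw [this, Real.log_pow]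
    push_cast
    have := Real.log_two_lt_d9
    nlinarith [(Nat.cast_nonneg n : (0 : ℝ) ≤ n)]
  refine ⟨σ, fun x => ?_⟩
  have hB : Real.log (Fintype.card (ℤˣ × Cube n)) / lam + lam * Fintype.card ι / 2 ≤
      (n + 1) / lam + lam * Fintype.card ι / 2 := by gcongr
  have h1 := (hσ (1, x)).trans hB
  have h2 := (hσ (-1, x)).trans hB
  simp only [Units.val_one, Int.cast_one, one_mul, Units.val_neg, Int.cast_neg, neg_mul, mul_neg,
    Finset.sum_neg_distrib] at h1 h2
  exact abs_le.2 ⟨by rw [edgeForm]; linarith, h1⟩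

end Polynomial

/-- The triples `{x_i, y_j, z_{i+j}}` with `i, j ∈ ZMod m`: the vertices are `Fin 3 × ZMod m`, and
`none` provides the additional vertex. -/
lemma exists_partialSteinerTripleSystem (m : ℕ) [NeZero m] :
    ∃ (n : ℕ) (z : Fin n) (T : ZMod m × ZMod m → Finset (Fin n)),
      n = 3 * m + 1 ∧ IsPartialSteinerTripleSystem T ∧ ∀ e, z ∉ T e := by
  let v : Option (Fin 3 × ZMod m) ≃ Fin (3 * m + 1) := Fintype.equivFinOfCardEq (by simp)
  refine ⟨3 * m + 1, v none, fun e => ({some (0, e.1), some (1, e.2), some (2, e.1 + e.2)} :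
    Finset (Option (Fin 3 × ZMod m))).map v.toEmbedding, rfl, ⟨fun e => ?_, fun e e' hne => ?_⟩,
    fun e => by simp⟩
  · rw [Finset.card_map, Finset.card_eq_three]
    exact ⟨_, _, _, by simp, by simp, by simp, rfl⟩
  · rw [← Finset.map_inter, Finset.card_map, Finset.card_le_one]
    have hne' : ¬ (e.1 = e'.1 ∧ e.2 = e'.2) := fun h => hne (Prod.ext h.1 h.2)
    intro a ha b hb
    simp only [Finset.mem_inter, Finset.mem_insert, Finset.mem_singleton] at ha hb
    obtain ⟨ha, ha'⟩ := ha
    obtain ⟨hb, hb'⟩ := hb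
    rcases ha with rfl | rfl | rfl <;> rcases hb with rfl | rfl | rfl <;> simp at ha' hb' ⊢ <;>
      grind

end QuantumQuery

open QuantumQuery in
theorem mainTheorem1 (C : ℝ) (hC : 0 < C) :
    ∃ (n : ℕ) (ε : ℝ) (f : MvPolynomial (Fin n) ℝ),
      0 < ε ∧ f.totalDegree = 4 ∧ QuantumQuery.IsBoundedOnCube f ∧
        ¬ ∃ A : QuantumQuery.Algorithm n 2, ∀ x : QuantumQuery.Cube n,
          |A.expectation x - C * MvPolynomial.eval x.toReal f| < ε := by
  obtain ⟨m, hm⟩ := exists_nat_gt (480 / C ^ 2 + 1)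
  have hm1 : (1 : ℝ) < m := lt_of_le_of_lt (by linarith [show 0 ≤ 480 / C ^ 2 by positivity]) hm
  have hm0 : 0 < m := by exact_mod_cast zero_lt_one.trans hm1
  have : NeZero m := ⟨hm0.ne'⟩
  obtain ⟨n, z, T, hn, hT, hz⟩ := exists_partialSteinerTripleSystem m
  obtain ⟨σ, hσ⟩ := exists_signs_abs_edgeForm_le z T (show 0 < C / 12 by positivity)
  set B : ℝ := (n + 1) / (C / 12) + C / 12 * Fintype.card (ZMod m × ZMod m) / 2 with hB
  have hcard : (Fintype.card (ZMod m × ZMod m) : ℝ) = (m : ℝ) ^ 2 := by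
    simp [ZMod.card, sq]
  have hBpos : 0 < B := by rw [hB, hcard]; positivity
  -- The constant `6` is the correlation bound `5` plus the error `ε * B = 1`.
  have hlarge : 6 * B < C * (m : ℝ) ^ 2 := by
    have h1 : 480 < C ^ 2 * m := by
      rw [← div_lt_iff₀' (by positivity)]
      linarith
    have h2 : ((n : ℝ) + 1) / (C / 12) < C * (m : ℝ) ^ 2 / 8 := by
      rw [div_lt_iff₀ (by positivity), hn]
      push_cast
      nlinarith
    rw [hB, hcard]
    nlinarith [show 0 < C * (m : ℝ) ^ 2 by positivity]
  have heval (x : Cube n) : MvPolynomial.eval x.toReal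
      (MvPolynomial.C B⁻¹ * edgePolynomial z T σ) = B⁻¹ * edgeForm z T σ x := by
    rw [map_mul, MvPolynomial.eval_C, eval_edgePolynomial]
  have hsq : ∑ x : Cube n, edgeForm z T σ x ^ 2 = 2 ^ n * (m : ℝ) ^ 2 := by
    rw [sum_edgeForm_sq hT hz, hcard]
  refine ⟨n, B⁻¹, MvPolynomial.C B⁻¹ * edgePolynomial z T σ, inv_pos.2 hBpos, ?_, fun x => ?_, ?_⟩
  · refine ((isHomogeneous_edgePolynomial hT hz σ).C_mul _).totalDegree fun h0 => ?_
    have hzero (x : Cube n) : edgeForm z T σ x = 0 := by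
      have := heval x
      rw [h0, map_zero] at this
      simpa [hBpos.ne'] using this.symm
    simp only [hzero] at hsq
    have : (0 : ℝ) < 2 ^ n * (m : ℝ) ^ 2 := by positivity
    rw [← hsq] at this
    simp at this
  · rw [heval, Set.mem_Icc, ← abs_le, abs_mul, abs_of_pos (inv_pos.2 hBpos),
      inv_mul_le_one₀ hBpos]
    exact hσ x
  · rintro ⟨A, hA⟩
    have h1 := (le_abs_self _).trans (abs_sum_edgeForm_mul_expectation_le A hT hz σ)
    have h2 (x : Cube n) : C * B⁻¹ * edgeForm z T σ x ^ 2 - 1 ≤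
        edgeForm z T σ x * A.expectation x := by
      have h3 := hA x
      rw [heval] at h3
      have h4 : |edgeForm z T σ x * (A.expectation x - C * (B⁻¹ * edgeForm z T σ x))| ≤ 1 := by
        rw [abs_mul]
        calc _ ≤ B * B⁻¹ := mul_le_mul (hσ x) h3.le (abs_nonneg _) hBpos.le
          _ = 1 := mul_inv_cancel₀ hBpos.ne'
      have := (abs_le.1 h4).1
      nlinarith
    have h5 := (Finset.sum_le_sum fun x (_ : x ∈ Finset.univ) => h2 x).trans h1
    rw [Finset.sum_sub_distrib, ← Finset.mul_sum, hsq] at h5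
    have h6 : ∑ _x : Cube n, (1 : ℝ) = 2 ^ n := by simp
    rw [h6] at h5
    have h7 : (6 : ℝ) < C * B⁻¹ * (m : ℝ) ^ 2 := by
      rw [mul_right_comm, ← div_eq_mul_inv, lt_div_iff₀ hBpos]
      exact hlarge
    have h8 : (0 : ℝ) < 2 ^ n := by positivity
    nlinarith
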